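/- Let $K$ be a number field of degree $d$ over $\mathbb{Q}$ with ring of integers $\mathcal{O}_K$, fix a $\mathbb{Z}$-basis $e_1,\ldots,e_d$ of $\mathcal{O}_K$, let $K_\mathbb{R}:=K\otimes_\mathbb{Q}\mathbb{R}\cong\mathbb{R}^d$ and let $n\ge 0$ be an integer. For $L>0$ write $$B(L):=\{l_1e_1+\cdots+l_de_d : l_i\in\mathbb{Z},\ |l_i|<L \text{ for all } i\}\subset\mathcal{O}_K.$$ An \emph{$\mathcal{O}_K$-lattice} in $K^n$ is an $\mathcal{O}_K$-submodule $\Gamma\subseteq K^n$ that is discrete in $K_\mathbb{R}^n\cong\mathbb{R}^{nd}$; it has \emph{full rank} if its $K$-span is $K^n$. A \emph{convex body} in $K_\mathbb{R}^n$ is a convex, open, non-empty and bounded subset. For a real number $r\ge 1$, a set $B\subseteq K_\mathbb{R}^n$ is \emph{$r$-thick} if $e_i\cdot B\subseteq r\cdot B$ for all $1\le i\le d$. For every real number $r\ge 1$ there are integers $D_1,D_2>0$, depending only on $K$, $e_1,\ldots,e_d$, $n$ and $r$, such that the following holds. Let $\Gamma\subseteq K^n$ be an $\mathcal{O}_K$-lattice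 of full rank and let $B\subset K_\mathbb{R}^n$ be an $r$-thick centrally symmetric convex body. Then there exist $v_1,\ldots,v_n\in K^n$ and positive integers $L_1,\ldots,L_n$ such that the $\mathcal{O}_K$-GAPs $$P_1:=\{l_1v_1+\cdots+l_nv_n : l_j\in B(L_j)\text{ for all } j\},\qquad P_2:=\{l_1v_1+\cdots+l_nv_n : l_j\in B(D_1L_j)\text{ for all } j\}$$ satisfy $$P_1\subseteq B\cap\Gamma\subseteq \tfrac{1}{D_2}\cdot P_2.$$ -/

import Mathlib

open scoped TensorProduct Pointwise NumberField

noncomputable section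

namespace OKGeom

variable (K : Type*) [Field K] [NumberField K]

/-- `K_ℝ = K ⊗_ℚ ℝ` as an `ℝ`-algebra (scalars written on the left). -/
abbrev KR : Type _ := ℝ ⊗[ℚ] K

variable {K}

/-- The inclusion `K^n → K_ℝ^n`, coordinatewise `a ↦ 1 ⊗ a`. -/
def embed {n : ℕ} (x : Fin n → K) : Fin n → KR K :=
  fun j => (1 : ℝ) ⊗ₜ[ℚ] x j

variable {d : ℕ} (e : Module.Basis (Fin d) ℤ (𝓞 K))

/-- The `ℝ`-basis `1 ⊗ e_1, …, 1 ⊗ e_d` of `K_ℝ` given by a `ℤ`-basis of `𝓞 K`. -/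
def basisKR : Module.Basis (Fin d) ℝ (KR K) :=
  Algebra.TensorProduct.basis ℝ (e.localizationLocalization ℚ (nonZeroDivisors ℤ) K)

/-- The identification `K_ℝ^n ≃ ℝ^{nd}` by coordinates in the basis `1 ⊗ e_i`; it carries the
topology and the bounded sets of the finite-dimensional real vector space `K_ℝ^n`. -/
def coords (n : ℕ) : (Fin n → KR K) ≃ₗ[ℝ] (Fin n → Fin d → ℝ) :=
  LinearEquiv.piCongrRight fun _ => (basisKR e).equivFun

/-- The open ball `B(L)` in `𝓞 K` for the norm `‖∑ l_i e_i‖ = max |l_i|`. -/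
def ball (L : ℕ) : Set (𝓞 K) := {x | ∀ i, |e.repr x i| < (L : ℤ)}

/-- The `𝓞 K`-GAP `{v₀ + l_1 v_1 + ⋯ + l_m v_m : l_j ∈ B(L_j)}` in a `𝓞 K`-module. -/
def gap {V : Type*} [AddCommGroup V] [Module (𝓞 K) V] {m : ℕ}
    (v₀ : V) (v : Fin m → V) (L : Fin m → ℕ) : Set V :=
  {x | ∃ l : Fin m → 𝓞 K, (∀ j, l j ∈ ball e (L j)) ∧ x = v₀ + ∑ j, l j • v j}

/-- An `𝓞 K`-submodule of `K^n` is an `𝓞 K`-lattice if it is discrete in `K_ℝ^n ≃ ℝ^{nd}`. -/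
def IsOKLattice {n : ℕ} (Γ : Submodule (𝓞 K) (Fin n → K)) : Prop :=
  DiscreteTopology ((fun x => coords e n (embed x)) '' (Γ : Set (Fin n → K)))

/-- The `K`-span of `Γ` is all of `K^n`, i.e. the `𝓞 K`-rank of `Γ` is `n`. -/
def IsFullRank {n : ℕ} (Γ : Submodule (𝓞 K) (Fin n → K)) : Prop :=
  Submodule.span K (Γ : Set (Fin n → K)) = ⊤

/-- Centrally symmetric convex bodies in `K_ℝ^n`; a convex body is convex, open, non-empty and
bounded. -/
structure IsSymmConvexBody {n : ℕ} (B : Set (Fin n → KR K)) : Prop where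
  convex : Convex ℝ B
  isOpen : IsOpen (coords e n '' B)
  nonempty : B.Nonempty
  bounded : Bornology.IsBounded (coords e n '' B)
  symm : ∀ x ∈ B, -x ∈ B

/-- `B ⊆ K_ℝ^n` is `r`-thick if `e_i · B ⊆ r · B` for all `i`. -/
def IsThick {n : ℕ} (r : ℝ) (B : Set (Fin n → KR K)) : Prop :=
  ∀ i, ((1 : ℝ) ⊗ₜ[ℚ] ((e i : 𝓞 K) : K) : KR K) • B ⊆ r • B

end OKGeom

end

namespace OKGeom

open Module

/-! The gauge of `B` is a norm `N` on `K^n` for which each `e i` acts with norm at most `r`. Let `b`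
be a `K`-basis whose successive members are shortest vectors of `Γ` outside the `K`-span of the
previous ones, and take `L j` of size `1 / (n d r N (b j))`. The inner inclusion is then the
triangle inequality.

For the outer one, Dirichlet approximation makes `q • x`, with `q ≤ m ^ (n * d)`, differ from an `𝓞
K`-combination of the `b j` by a vector too short to have a nonzero last coordinate, by minimality.
Iterating bounds the denominators (`exists_integral_repr`); applying the same rounding to a rescaled
`x` bounds the coordinates (`abs_repr_le`). -/

/-- Simultaneous Dirichlet approximation with a uniform bound for the denominator. -/
theorem exists_simultaneous_approx (ι : Type*) [Fintype ι] {m : ℕ} (hm : 0 < m) (y : ι → ℚ) :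
    ∃ q : ℕ, 0 < q ∧ q ≤ m ^ Fintype.card ι ∧ ∃ z : ι → ℤ, ∀ i, |q * y i - z i| ≤ 1 / (m : ℚ) := by
  classical
  have hm' : (0 : ℚ) < m := by exact_mod_cast hm
  have hlt : ∀ x : ℚ, ⌊(m : ℚ) * Int.fract x⌋.toNat < m := fun x => by
    have h1 : ⌊(m : ℚ) * Int.fract x⌋ < m := by
      rw [Int.floor_lt]
      simpa using mul_lt_mul_of_pos_left (Int.fract_lt_one x) hm'
    omega
  -- Pigeonhole: `m ^ card + 1` multiples of `y` fall into `m ^ card` boxes of side `1 / m`.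
  let f : Fin (m ^ Fintype.card ι + 1) → (ι → Fin m) := fun k i =>
    ⟨⌊(m : ℚ) * Int.fract ((k : ℕ) * y i)⌋.toNat, hlt _⟩
  obtain ⟨k, k', hne, hk⟩ := Fintype.exists_ne_map_eq_of_card_lt f (by simp)
  wlog hkk : k' < k generalizing k k'
  · exact this k' k hne.symm hk.symm (lt_of_le_of_ne (not_lt.mp hkk) hne)
  have hkk' : (k' : ℕ) < k := hkk
  refine ⟨k - k', by omega, by omega, fun i => ⌊(k : ℕ) * y i⌋ - ⌊(k' : ℕ) * y i⌋, fun i => ?_⟩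
  have hi : ⌊(m : ℚ) * Int.fract ((k : ℕ) * y i)⌋ = ⌊(m : ℚ) * Int.fract ((k' : ℕ) * y i)⌋ := by
    have h := congrArg Fin.val (congrFun hk i)
    simp only [f] at h
    have h0 : ∀ x : ℚ, 0 ≤ ⌊(m : ℚ) * Int.fract x⌋ := fun x =>
      Int.floor_nonneg.2 (mul_nonneg hm'.le (Int.fract_nonneg x))
    have := h0 ((k : ℕ) * y i)
    have := h0 ((k' : ℕ) * y i)
    omega
  have hlt1 := Int.abs_sub_lt_one_of_floor_eq_floor hi
  rw [← mul_sub, abs_mul, abs_of_pos hm'] at hlt1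
  have heq : ((k - k' : ℕ) : ℚ) * y i - ((⌊(k : ℕ) * y i⌋ - ⌊(k' : ℕ) * y i⌋ : ℤ) : ℚ) =
      Int.fract ((k : ℕ) * y i) - Int.fract ((k' : ℕ) * y i) := by
    rw [Nat.cast_sub hkk'.le]
    push_cast
    simp only [Int.fract]
    ring
  rw [heq, le_div_iff₀ hm', mul_comm]
  exact hlt1.le

/-! ### Rational coordinates, thick norms and minimal bases -/

section Coordinates

variable {K : Type*} [Field K] [NumberField K] {d : ℕ} (e : Basis (Fin d) ℤ (𝓞 K))

/-- The `ℚ`-basis of `K` given by a `ℤ`-basis of `𝓞 K`. -/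
noncomputable abbrev ratBasis : Basis (Fin d) ℚ K :=
  e.localizationLocalization ℚ (nonZeroDivisors ℤ) K

theorem ratBasis_apply (i : Fin d) : ratBasis e i = ((e i : 𝓞 K) : K) :=
  Basis.localizationLocalization_apply ℚ (nonZeroDivisors ℤ) K e i

theorem ratBasis_repr_coe (x : 𝓞 K) (i : Fin d) :
    (ratBasis e).repr (x : K) i = (e.repr x i : ℚ) :=
  Basis.localizationLocalization_repr_algebraMap ℚ (nonZeroDivisors ℤ) K e x i

theorem ratBasis_repr_ratCast_mul (t : ℚ) (a : K) (i : Fin d) :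
    (ratBasis e).repr ((t : K) * a) i = t * (ratBasis e).repr a i := by
  rw [← Rat.smul_def, map_smul, Finsupp.smul_apply, smul_eq_mul]

theorem ratBasis_repr_natCast_mul (t : ℕ) (a : K) (i : Fin d) :
    (ratBasis e).repr ((t : K) * a) i = t * (ratBasis e).repr a i := by
  simpa using ratBasis_repr_ratCast_mul e t a i

/-- Simultaneous approximation of a vector over `K` by integral vectors. -/
theorem exists_integral_approx {m : ℕ} (hm : 0 < m) {n : ℕ} (a : Fin n → K) :
    ∃ q : ℕ, 0 < q ∧ q ≤ m ^ (n * d) ∧ ∃ l : Fin n → 𝓞 K, (∀ j, a j = 0 → l j = 0) ∧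
      ∀ j i, |(ratBasis e).repr (q * a j - l j) i| ≤ 1 / (m : ℚ) := by
  classical
  obtain ⟨q, hq, hqm, z, hz⟩ := exists_simultaneous_approx (Fin n × Fin d) hm
    (fun p => (ratBasis e).repr (a p.1) p.2)
  refine ⟨q, hq, by simpa using hqm,
    -- Rounding zero entries to zero keeps the remainder supported where `a` is.
    fun j => if a j = 0 then 0 else ∑ i, z (j, i) • e i, fun j hj => by simp [hj], fun j i => ?_⟩
  by_cases hj : a j = 0
  · simp [hj]
  · have hrepr : e.repr (∑ i, z (j, i) • e i) i = z (j, i) := congrFun (e.repr_sum_self fun i => z (j, i)) i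
    simp only [if_neg hj]
    rw [map_sub, Finsupp.sub_apply, ratBasis_repr_natCast_mul, ratBasis_repr_coe, hrepr]
    exact hz (j, i)

variable {W : Type*} [AddCommGroup W] [Module K W]

/-- A norm on a `K`-vector space for which multiplication by each `e i` has norm at most `r`. -/
structure IsThickNorm (r : ℝ) (N : W → ℝ) : Prop where
  add_le : ∀ x y, N (x + y) ≤ N x + N y
  rat_smul : ∀ (t : ℚ) (x : W), N ((t : K) • x) = |(t : ℝ)| * N x
  thick : ∀ i x, N (((e i : 𝓞 K) : K) • x) ≤ r * N x
  pos : ∀ x, x ≠ 0 → 0 < N x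

namespace IsThickNorm

set_option linter.unusedSectionVars false

variable {e} {r : ℝ} {N : W → ℝ} (hN : IsThickNorm e r N)
include hN

theorem zero : N 0 = 0 := by simpa using hN.rat_smul 0 0

theorem nonneg (x : W) : 0 ≤ N x := by
  rcases eq_or_ne x 0 with rfl | hx
  · exact hN.zero.ge
  · exact (hN.pos x hx).le

theorem natCast_smul (t : ℕ) (x : W) : N ((t : K) • x) = t * N x := by
  simpa using hN.rat_smul t x

theorem neg (x : W) : N (-x) = N x := by
  simpa using hN.rat_smul (-1) x

theorem sub_le (x y : W) : N (x - y) ≤ N x + N y := by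
  rw [sub_eq_add_neg, ← hN.neg y]
  exact hN.add_le _ _

theorem sum_le {ι : Type*} (s : Finset ι) (f : ι → W) : N (∑ i ∈ s, f i) ≤ ∑ i ∈ s, N (f i) :=
  Finset.le_sum_of_subadditive N hN.zero.le hN.add_le s f

/-- Expand `a` in the basis `e i`: each of the `d` terms costs at most `M * r`. -/
theorem smul_le {a : K} {M : ℝ} (ha : ∀ i, |((ratBasis e).repr a i : ℝ)| ≤ M) (w : W) :
    N (a • w) ≤ d * r * M * N w := by
  have hM : ∀ i : Fin d, 0 ≤ M := fun i => (abs_nonneg _).trans (ha i)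
  calc N (a • w) = N (∑ i, (((ratBasis e).repr a i : ℚ) : K) • ((e i : 𝓞 K) : K) • w) := by
        congr 1
        conv_lhs => rw [← (ratBasis e).sum_repr a, Finset.sum_smul]
        exact Finset.sum_congr rfl fun i _ => by rw [ratBasis_apply, Rat.smul_def, mul_smul]
    _ ≤ ∑ i : Fin d, M * (r * N w) := by
        refine (hN.sum_le _ _).trans (Finset.sum_le_sum fun i _ => ?_)
        rw [hN.rat_smul]
        exact mul_le_mul (ha i) (hN.thick i w) (hN.nonneg _) (hM i)
    _ = d * r * M * N w := by simp; ring

end IsThickNorm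

/-- A `K`-basis whose `k`-th vector is a shortest element of `Γ` outside the span of the previous
ones. -/
structure IsMinimalBasis {n : ℕ} (Γ : AddSubgroup W) (N : W → ℝ) (b : Basis (Fin n) K W) :
    Prop where
  smul_mem : ∀ (l : 𝓞 K) j, (l : K) • b j ∈ Γ
  le_of_repr_ne_zero : ∀ x ∈ Γ, ∀ k, (∃ j, k ≤ j ∧ b.repr x j ≠ 0) → N (b k) ≤ N x

namespace IsMinimalBasis

variable {e} {n : ℕ} {r : ℝ} {N : W → ℝ} {Γ : AddSubgroup W} {b : Basis (Fin n) K W}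
  (hN : IsThickNorm e r N) (hb : IsMinimalBasis Γ N b)
include hb

theorem monotone {j k : Fin n} (hjk : j ≤ k) : N (b j) ≤ N (b k) :=
  hb.le_of_repr_ne_zero _ (by simpa using hb.smul_mem 1 k) j ⟨k, hjk, by simp⟩

set_option linter.unusedSectionVars false in
theorem sum_mem (l : Fin n → 𝓞 K) : ∑ j, (l j : K) • b j ∈ Γ :=
  Γ.sum_mem fun _ _ => hb.smul_mem _ _

-- Rounding errors cost at most half of the `k`-th minimum; this fixes how large `m` must be.
include hN in
theorem le_half_of_small (hr : 0 ≤ r) {m : ℕ} (hm : 0 < m) (hmr : 2 * n * d * r ≤ m) {x : W}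
    {k : Fin n} (hk : ∀ j, k < j → b.repr x j = 0)
    (hx : ∀ j i, |(ratBasis e).repr (b.repr x j) i| ≤ 1 / (m : ℚ)) : N x ≤ N (b k) / 2 := by
  have hm' : (0 : ℝ) < m := by exact_mod_cast hm
  have hterm : ∀ j, N (b.repr x j • b j) ≤ d * r * (1 / m) * N (b k) := fun j => by
    rcases le_or_gt j k with hj | hj
    · refine (hN.smul_le (M := 1 / m) (fun i => ?_) _).trans ?_
      · have h := (Rat.cast_le (K := ℝ)).2 (hx j i)
        push_cast at h
        exact h
      exact mul_le_mul_of_nonneg_left (hb.monotone hj) (by positivity)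
    · rw [hk j hj, zero_smul, hN.zero]
      have := hN.nonneg (b k)
      positivity
  calc N x = N (∑ j, b.repr x j • b j) := by rw [b.sum_repr]
    _ ≤ ∑ j : Fin n, d * r * (1 / m) * N (b k) :=
        (hN.sum_le _ _).trans (Finset.sum_le_sum fun j _ => hterm j)
    _ = (2 * n * d * r) / m * (N (b k) / 2) := by simp; ring
    _ ≤ 1 * (N (b k) / 2) := by
        have := hN.nonneg (b k)
        gcongr
        exact (div_le_one hm').2 hmr
    _ = N (b k) / 2 := one_mul _

omit hb [NumberField K] in
theorem repr_sum_smul (l : Fin n → 𝓞 K) (j : Fin n) :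
    b.repr (∑ j, (l j : K) • b j) j = l j := 
  congrFun (b.repr_sum_self fun j => (l j : K)) j

include hN in
/-- Coordinates of elements of `Γ` have bounded denominators. -/
theorem exists_integral_repr (hr : 0 ≤ r) {m : ℕ} (hm : 0 < m) (hmr : 2 * n * d * r ≤ m)
    (k : ℕ) (hkn : k ≤ n) {x : W} (hxΓ : x ∈ Γ) (hx : ∀ j : Fin n, k ≤ j → b.repr x j = 0)
    (j : Fin n) :
    ∃ l : 𝓞 K, (((m ^ (n * d)).factorial ^ k : ℕ) : K) * b.repr x j = l := by
  induction k generalizing x with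
  | zero => exact ⟨0, by simp [hx j (Nat.zero_le _)]⟩
  | succ k ih =>
    set k' : Fin n := ⟨k, hkn⟩ with hk'
    obtain ⟨q, hq, hqm, l, hl0, hl⟩ := exists_integral_approx e hm fun j => b.repr x j
    set y : W := (q : K) • x - ∑ j, (l j : K) • b j with hy
    have hrepr : ∀ j, b.repr y j = q * b.repr x j - l j := fun j => by
      rw [hy, map_sub, Finsupp.sub_apply, repr_sum_smul, map_smul, Finsupp.smul_apply, smul_eq_mul]
    have hyΓ : y ∈ Γ := by
      refine Γ.sub_mem ?_ (hb.sum_mem l)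
      rw [Nat.cast_smul_eq_nsmul]
      exact Γ.nsmul_mem hxΓ q
    have hy0 : ∀ j, k' < j → b.repr y j = 0 := fun j hj => by
      have h0 := hx j (Nat.succ_le_of_lt hj)
      rw [hrepr, h0, hl0 j h0]
      simp
    have hsmall : N y ≤ N (b k') / 2 :=
      hb.le_half_of_small hN hr hm hmr hy0 fun j i => by rw [hrepr]; exact hl j i
    -- The remainder lies in `Γ` and is shorter than `b k'`, so its `k'`-th coordinate vanishes too.
    have hy0' : ∀ j : Fin n, k ≤ j → b.repr y j = 0 := fun j hj => by
      by_contra hne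
      have h1 := hb.le_of_repr_ne_zero y hyΓ k' ⟨j, hj, hne⟩
      have h2 := hN.pos (b k') (b.ne_zero k')
      linarith
    obtain ⟨l', hl'⟩ := ih (by omega) hyΓ hy0'
    obtain ⟨c, hc⟩ := Nat.dvd_factorial hq hqm
    -- With `q * c = Q!` for `Q = m ^ (n * d)`, one extra factor `Q!` clears the denominator `q`.
    refine ⟨c * (l' + ((m ^ (n * d)).factorial ^ k : ℕ) * l j), ?_⟩
    rw [hrepr] at hl'
    have hcK : (((m ^ (n * d)).factorial : ℕ) : K) = q * c := by rw [hc, Nat.cast_mul]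
    have hval : ((c * (l' + ((m ^ (n * d)).factorial ^ k : ℕ) * l j) : 𝓞 K) : K) =
        c * (l' + ((m ^ (n * d)).factorial ^ k : ℕ) * l j) := by simp
    rw [hval, ← hl', pow_succ, Nat.cast_mul, hcK]
    ring

include hN in
/-- The coordinates of a vector supported up to `k`: bound for the last one. -/
theorem abs_repr_last_le (hr : 0 ≤ r) {m : ℕ} (hm : 0 < m) (hmr : 2 * n * d * r ≤ m)
    {x : W} {k : Fin n} (hx : ∀ j, k < j → b.repr x j = 0) (i : Fin d) :
    |((ratBasis e).repr (b.repr x k) i : ℝ)| * N (b k) ≤ 2 * (m ^ (n * d) : ℕ) * N x := by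
  set Q : ℕ := m ^ (n * d) with hQ
  have hpos := hN.pos (b k) (b.ne_zero k)
  have hQ0 : (0 : ℝ) < Q := by exact_mod_cast pow_pos hm _
  rw [← le_div_iff₀ hpos]
  -- It suffices to beat each rational `t > 2 * Q * N x / N (b k)`; rationality keeps `t⁻¹ • x` in
  -- `W`.
  refine le_of_forall_gt_imp_ge_of_dense fun s hs => ?_
  obtain ⟨t, ht, hts⟩ := exists_rat_btwn hs
  refine le_trans ?_ hts.le
  have ht0 : (0 : ℝ) < t := lt_of_le_of_lt (div_nonneg (by have := hN.nonneg x; positivity) hpos.le) ht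
  have ht0' : (0 : ℚ) < t := by exact_mod_cast ht0
  rw [div_lt_iff₀ hpos] at ht
  set z : W := ((t⁻¹ : ℚ) : K) • x with hz
  have hzr : ∀ j, b.repr z j = ((t⁻¹ : ℚ) : K) * b.repr x j := fun j => by
    rw [hz, map_smul, Finsupp.smul_apply, smul_eq_mul]
  obtain ⟨q, hq, hqm, l, hl0, hl⟩ := exists_integral_approx e hm fun j => b.repr z j
  set w : W := ∑ j, (l j : K) • b j with hw
  have hrepr : ∀ j, b.repr ((q : K) • z - w) j = q * b.repr z j - l j := fun j => by
    rw [map_sub, Finsupp.sub_apply, hw, repr_sum_smul, map_smul, Finsupp.smul_apply, smul_eq_mul]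
  have hz0 : ∀ j, k < j → b.repr z j = 0 := fun j hj => by rw [hzr, hx j hj, mul_zero]
  have hsmall : N ((q : K) • z - w) ≤ N (b k) / 2 :=
    hb.le_half_of_small hN hr hm hmr
      (fun j hj => by rw [hrepr, hz0 j hj, hl0 j (hz0 j hj)]; simp)
      fun j i => by rw [hrepr]; exact hl j i
  have hNz : N ((q : K) • z) < N (b k) / 2 := by
    rw [hN.natCast_smul, hz, hN.rat_smul, Rat.cast_inv, abs_of_pos (inv_pos.2 ht0)]
    have hqQ : (q : ℝ) ≤ Q := by exact_mod_cast hqm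
    calc (q : ℝ) * ((t : ℝ)⁻¹ * N x) ≤ Q * ((t : ℝ)⁻¹ * N x) := by
          have := hN.nonneg x
          gcongr
      _ = (2 * Q * N x) * (t : ℝ)⁻¹ / 2 := by ring
      _ < (t * N (b k)) * (t : ℝ)⁻¹ / 2 := by gcongr
      _ = N (b k) / 2 := by field_simp
  have hNw : N w < N (b k) := by
    have h := hN.sub_le ((q : K) • z) ((q : K) • z - w)
    rw [sub_sub_cancel] at h
    linarith
  -- The rounded vector `w` is in `Γ` and shorter than `b k`, so `l k = 0`; hence the `k`-th
  -- coordinate of `q • z` is itself a rounding error.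
  have hlk : (l k : K) = 0 := by
    by_contra hne
    refine absurd (hb.le_of_repr_ne_zero w (hb.sum_mem l) k ⟨k, le_rfl, ?_⟩) (not_le.2 hNw)
    rwa [hw, repr_sum_smul]
  have hlast := hl k i
  rw [hlk, sub_zero, ratBasis_repr_natCast_mul, hzr, ratBasis_repr_ratCast_mul, abs_mul, abs_mul,
    Nat.abs_cast, abs_of_pos (inv_pos.2 ht0')] at hlast
  have hq1 : (1 : ℚ) ≤ q := by exact_mod_cast hq
  have hm1 : 1 / (m : ℚ) ≤ 1 := (div_le_one (by exact_mod_cast hm)).2 (by exact_mod_cast hm)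
  set c := |(ratBasis e).repr (b.repr x k) i| with hc
  have hcn : 0 ≤ t⁻¹ * c := mul_nonneg (inv_pos.2 ht0').le (abs_nonneg _)
  have h1 : t⁻¹ * c ≤ 1 := by nlinarith
  have h2 : c ≤ t := by
    rwa [inv_mul_le_iff₀ ht0', mul_one] at h1
  have h3 := (Rat.cast_le (K := ℝ)).2 h2
  rwa [hc, Rat.cast_abs] at h3

include hN in
/-- The coordinates of a vector are controlled by its norm. -/
theorem abs_repr_le (hr : 0 ≤ r) {m : ℕ} (hm : 0 < m) (hmr : 2 * n * d * r ≤ m) (k : ℕ)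
    (hkn : k ≤ n) {x : W} (hx : ∀ j : Fin n, k ≤ j → b.repr x j = 0) (j : Fin n) (i : Fin d) :
    |((ratBasis e).repr (b.repr x j) i : ℝ)| * N (b j) ≤
      2 * (m ^ (n * d) : ℕ) * (1 + d * r * (2 * (m ^ (n * d) : ℕ))) ^ k * N x := by
  set C : ℝ := 2 * (m ^ (n * d) : ℕ) with hC
  have hC0 : 0 ≤ C := by positivity
  induction k generalizing x with
  | zero =>
    have := hN.nonneg x
    rw [hx j (Nat.zero_le _)]
    simp only [map_zero, Finsupp.zero_apply, Rat.cast_zero, abs_zero, zero_mul]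
    positivity
  | succ k ih =>
    set k' : Fin n := ⟨k, hkn⟩ with hk'
    have hlast : ∀ i, |((ratBasis e).repr (b.repr x k') i : ℝ)| * N (b k') ≤ C * N x :=
      hb.abs_repr_last_le hN hr hm hmr fun j hj => hx j (Nat.succ_le_of_lt hj)
    have hpos := hN.pos (b k') (b.ne_zero k')
    have hx0 := hN.nonneg x
    rcases eq_or_ne j k' with rfl | hj
    · refine (hlast i).trans (mul_le_mul_of_nonneg_right ?_ hx0)
      exact le_mul_of_one_le_right hC0 (one_le_pow₀ (by linarith [show 0 ≤ d * r * C by positivity]))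
    set y : W := x - b.repr x k' • b k' with hy
    have hrepr : ∀ j, j ≠ k' → b.repr y j = b.repr x j := fun j hj => by
      simp [hy, Finsupp.single_eq_of_ne hj]
    have hy0 : ∀ j : Fin n, k ≤ j → b.repr y j = 0 := fun j hj => by
      rcases eq_or_ne j k' with rfl | hne
      · simp [hy]
      · rw [hrepr j hne]
        exact hx j (Nat.succ_le_of_lt (lt_of_le_of_ne hj fun h => hne (Fin.ext h.symm)))
    -- Removing the last coordinate inflates the norm by a bounded factor, hence the `k`-th power in
    -- the constant.
    have hNy : N y ≤ (1 + d * r * C) * N x := by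
      have h := hN.smul_le (M := C * N x / N (b k')) (a := b.repr x k')
        (fun i => (le_div_iff₀ hpos).2 (hlast i)) (b k')
      rw [mul_assoc, div_mul_cancel₀ _ hpos.ne'] at h
      linarith [hN.sub_le x (b.repr x k' • b k')]
    have h := ih (by omega) hy0
    rw [hrepr j hj] at h
    refine h.trans ((mul_le_mul_of_nonneg_left hNy (by positivity)).trans_eq ?_)
    ring

end IsMinimalBasis

end Coordinates

/-! ### Successive shortest vectors -/

section Minima

variable {K : Type*} [Field K] {W : Type*} [AddCommGroup W] [Module K W]

theorem exists_shortest_notMem_span {Γ : AddSubgroup W} {N : W → ℝ}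
    (hspan : Submodule.span K (Γ : Set W) = ⊤) (hfin : ∀ R, {x | x ∈ Γ ∧ N x ≤ R}.Finite)
    {p : Submodule K W} (hp : p ≠ ⊤) :
    ∃ w ∈ Γ, w ∉ p ∧ ∀ x ∈ Γ, x ∉ p → N w ≤ N x := by
  obtain ⟨y, hyΓ, hyp⟩ : ∃ y ∈ Γ, y ∉ p := by
    by_contra! h
    exact hp (top_le_iff.1 (hspan ▸ Submodule.span_le.2 h))
  obtain ⟨w, ⟨⟨hwΓ, hwN⟩, hwp⟩, hmin⟩ := Set.exists_min_image ({x | x ∈ Γ ∧ N x ≤ N y} \ p) N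
    ((hfin (N y)).subset Set.sdiff_subset) ⟨y, ⟨hyΓ, le_rfl⟩, hyp⟩
  refine ⟨w, hwΓ, hwp, fun x hxΓ hxp => ?_⟩
  rcases le_total (N x) (N y) with h | h
  · exact hmin x ⟨⟨hxΓ, h⟩, hxp⟩
  · exact hwN.trans h

theorem span_image_Iio_ne_top [FiniteDimensional K W] (v : ℕ → W) {k : ℕ} (hk : k < finrank K W) :
    Submodule.span K (v '' Set.Iio k) ≠ ⊤ := fun h => by
  classical
  have h1 := finrank_span_finset_le_card (R := K) ((Finset.range k).image v)
  rw [Finset.coe_image, Finset.coe_range, Set.finrank, h, finrank_top] at h1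
  have h2 := Finset.card_image_le (s := Finset.range k) (f := v)
  rw [Finset.card_range] at h2
  omega

/-- Greedy choice. Indexing by `ℕ` makes each extension a `Function.update`; values from `k` on are
irrelevant. -/
theorem exists_successive_shortest [FiniteDimensional K W] {Γ : AddSubgroup W} {N : W → ℝ}
    (hspan : Submodule.span K (Γ : Set W) = ⊤) (hfin : ∀ R, {x | x ∈ Γ ∧ N x ≤ R}.Finite)
    (k : ℕ) (hk : k ≤ finrank K W) :
    ∃ v : ℕ → W, ∀ j < k, v j ∈ Γ ∧ v j ∉ Submodule.span K (v '' Set.Iio j) ∧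
      ∀ x ∈ Γ, x ∉ Submodule.span K (v '' Set.Iio j) → N (v j) ≤ N x := by
  induction k with
  | zero => exact ⟨0, fun j hj => absurd hj (Nat.not_lt_zero j)⟩
  | succ k ih =>
    obtain ⟨v, hv⟩ := ih (by omega)
    obtain ⟨w, hwΓ, hwp, hw⟩ := exists_shortest_notMem_span hspan hfin
      (span_image_Iio_ne_top v (Nat.lt_of_succ_le hk))
    have himage : ∀ j ≤ k, Function.update v k w '' Set.Iio j = v '' Set.Iio j := fun j hj =>
      Set.image_congr fun i hi => Function.update_of_ne (lt_of_lt_of_le hi hj).ne _ _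
    refine ⟨Function.update v k w, fun j hj => ?_⟩
    rw [himage j (Nat.le_of_lt_succ hj)]
    rcases Nat.lt_succ_iff_lt_or_eq.1 hj with h | rfl
    · rw [Function.update_of_ne h.ne]
      exact hv j h
    · rw [Function.update_self]
      exact ⟨hwΓ, hwp, hw⟩

theorem linearIndependent_of_notMem_span_image_Iio {v : ℕ → W} {k : ℕ}
    (hv : ∀ j < k, v j ∉ Submodule.span K (v '' Set.Iio j)) :
    LinearIndependent K fun i : Fin k => v i := by
  induction k with
  | zero => exact linearIndependent_empty_type
  | succ k ih =>
    rw [linearIndependent_finSucc']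
    refine ⟨ih fun j hj => hv j (by omega), ?_⟩
    have hrange : Set.range (Fin.init fun i : Fin (k + 1) => v i) = v '' Set.Iio k := by
      ext x
      constructor
      · rintro ⟨i, rfl⟩
        exact ⟨i, i.2, rfl⟩
      · rintro ⟨i, hi, rfl⟩
        exact ⟨⟨i, hi⟩, rfl⟩
    rw [hrange]
    exact hv k (Nat.lt_succ_self k)

theorem exists_isMinimalBasis {n : ℕ} (hn : finrank K W = n) [FiniteDimensional K W]
    {Γ : AddSubgroup W} (hΓ : ∀ (l : 𝓞 K), ∀ x ∈ Γ, (l : K) • x ∈ Γ) {N : W → ℝ}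
    (hspan : Submodule.span K (Γ : Set W) = ⊤) (hfin : ∀ R, {x | x ∈ Γ ∧ N x ≤ R}.Finite) :
    ∃ b : Basis (Fin n) K W, IsMinimalBasis Γ N b := by
  obtain ⟨v, hv⟩ := exists_successive_shortest hspan hfin n hn.ge
  have hli := linearIndependent_of_notMem_span_image_Iio fun j hj => (hv j hj).2.1
  rcases Nat.eq_zero_or_pos n with rfl | hpos
  · have := Module.finrank_zero_iff.1 hn
    exact ⟨Basis.empty W, fun _ j => j.elim0, fun _ _ k => k.elim0⟩
  have : Nonempty (Fin n) := ⟨⟨0, hpos⟩⟩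
  let b := basisOfLinearIndependentOfCardEqFinrank hli (by simp [hn])
  have hb : ∀ j, b j = v j := fun j => by
    simp [b]
  refine ⟨b, fun l j => hΓ l _ (hb j ▸ (hv j j.2).1), ?_⟩
  rintro x hx k ⟨j, hkj, hj⟩
  rw [hb]
  refine (hv k k.2).2.2 x hx fun hmem => ?_
  have himage : v '' Set.Iio (k : ℕ) = b '' Set.Iio k := by
    ext y
    constructor
    · rintro ⟨i, hi, rfl⟩
      exact ⟨⟨i, lt_trans hi k.2⟩, hi, hb _⟩
    · rintro ⟨i, hi, rfl⟩
      exact ⟨i, hi, (hb i).symm⟩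
  rw [himage, Basis.mem_span_image] at hmem
  exact absurd (hmem (Finsupp.mem_support_iff.2 hj)) (not_lt.2 hkj)

end Minima

/-! ### The norm defined by a convex body -/

section Gauge

variable {K : Type*} [Field K] [NumberField K] {d : ℕ} (e : Basis (Fin d) ℤ (𝓞 K)) {n : ℕ}

theorem coords_embed (x : Fin n → K) (j : Fin n) (i : Fin d) :
    coords e n (embed x) j i = ((ratBasis e).repr (x j) i : ℝ) := by
  simp [coords, embed, basisKR]

theorem embed_add (x y : Fin n → K) : embed (x + y) = embed x + embed y :=
  funext fun _ => TensorProduct.tmul_add _ _ _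

theorem embed_smul (a : K) (x : Fin n → K) :
    embed (a • x) = ((1 : ℝ) ⊗ₜ[ℚ] a : KR K) • embed x :=
  funext fun j => by simp [embed]

theorem coords_embed_rat_smul (t : ℚ) (x : Fin n → K) :
    coords e n (embed ((t : K) • x)) = (t : ℝ) • coords e n (embed x) := by
  ext j i
  simp only [coords_embed, Pi.smul_apply, smul_eq_mul, ratBasis_repr_ratCast_mul, Rat.cast_mul]

theorem coords_embed_injective : Function.Injective fun x : Fin n → K => coords e n (embed x) :=
  fun x y h => funext fun j => (ratBasis e).repr.injective <| Finsupp.ext fun i => by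
    have := congrFun (congrFun h j) i
    simpa only [coords_embed, Rat.cast_inj] using this

variable {e} {B : Set (Fin n → KR K)}

variable (e B) in
/-- The norm on `K^n` with open unit ball `B`. -/
noncomputable def bodyNorm (x : Fin n → K) : ℝ :=
  gauge (coords e n '' B) (coords e n (embed x))

namespace IsSymmConvexBody

variable (hB : IsSymmConvexBody e B)
include hB

theorem zero_mem : (0 : Fin n → KR K) ∈ B := by
  obtain ⟨x, hx⟩ := hB.nonempty
  simpa using hB.convex hx (hB.symm x hx) (by norm_num : (0 : ℝ) ≤ 1 / 2)
    (by norm_num : (0 : ℝ) ≤ 1 / 2) (by norm_num)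

theorem convex_image : Convex ℝ (coords e n '' B) :=
  hB.convex.linear_image (coords e n).toLinearMap

theorem zero_mem_image : (0 : Fin n → Fin d → ℝ) ∈ coords e n '' B :=
  ⟨0, hB.zero_mem, map_zero _⟩

theorem absorbent_image : Absorbent ℝ (coords e n '' B) :=
  absorbent_nhds_zero (hB.isOpen.mem_nhds hB.zero_mem_image)

theorem neg_mem_image : ∀ x ∈ coords e n '' B, -x ∈ coords e n '' B := by
  rintro _ ⟨x, hx, rfl⟩
  exact ⟨-x, hB.symm x hx, map_neg _ _⟩

theorem bodyNorm_lt_one_iff (x : Fin n → K) : bodyNorm e B x < 1 ↔ embed x ∈ B := by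
  have h := Set.ext_iff.1 (setOfPred_gauge_lt_one_eq_self_of_isOpen hB.convex_image
    hB.zero_mem_image hB.isOpen) (coords e n (embed x))
  exact h.trans ((coords e n).injective.mem_set_image)

/-- Convexity gives subadditivity, symmetry gives homogeneity for negative scalars, and boundedness
gives positivity. -/
theorem isThickNorm {r : ℝ} (hr : 0 ≤ r) (hthick : IsThick e r B) :
    IsThickNorm e r (bodyNorm e B) where
  add_le x y := by
    unfold bodyNorm
    rw [embed_add, map_add]
    exact gauge_add_le hB.convex_image hB.absorbent_image _ _
  rat_smul t x := by
    unfold bodyNorm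
    rw [coords_embed_rat_smul]
    rcases le_total 0 (t : ℝ) with ht | ht
    · rw [gauge_smul_of_nonneg ht, abs_of_nonneg ht, smul_eq_mul]
    · rw [← neg_neg (t : ℝ), neg_smul, gauge_neg hB.neg_mem_image,
        gauge_smul_of_nonneg (neg_nonneg.2 ht), abs_neg, abs_of_nonneg (neg_nonneg.2 ht),
        smul_eq_mul]
  thick i x := by
    -- The gauge is an infimum that need not be attained, so thickness is applied at dilates `t • B`
    -- with `t < s`.
    have key : ∀ s, bodyNorm e B x < s → bodyNorm e B (((e i : 𝓞 K) : K) • x) ≤ s * r := by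
      intro s hs
      obtain ⟨t, ht0, hts, htx⟩ := exists_lt_of_gauge_lt hB.absorbent_image hs
      obtain ⟨_, ⟨y, hy, rfl⟩, hyx⟩ := htx
      have hx : embed x = t • y := (coords e n).injective (by rw [map_smul]; exact hyx.symm)
      obtain ⟨z, hz, hzy⟩ := hthick i (Set.smul_mem_smul_set hy)
      have hmem : coords e n (embed (((e i : 𝓞 K) : K) • x)) ∈ (t * r) • (coords e n '' B) := by
        refine ⟨coords e n z, ⟨z, hz, rfl⟩, ?_⟩
        change (t * r) • coords e n z = _
        rw [embed_smul, hx, smul_comm, ← hzy, ← map_smul, mul_smul]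
      exact (gauge_le_of_mem (by positivity) hmem).trans (by gcongr)
    rw [mul_comm]
    refine le_of_forall_gt_imp_ge_of_dense fun s hs => ?_
    rcases hr.eq_or_lt with rfl | hr'
    · simp only [mul_zero] at hs key
      exact (key _ (lt_add_one _)).trans hs.le
    · have := key (s / r) ((lt_div_iff₀ hr').2 hs)
      rwa [div_mul_cancel₀ _ hr'.ne'] at this
  pos x hx := by
    refine (gauge_pos hB.absorbent_image
      (NormedSpace.isVonNBounded_of_isBounded ℝ hB.bounded)).2 fun h => hx ?_
    refine coords_embed_injective e (h.trans ?_)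
    ext j i
    simp [coords_embed]

/-- A discrete subgroup is closed, so it meets the bounded dilate of `B` by `|R| + 1 > R` in a
finite set. -/
theorem finite_bodyNorm_le {Γ : Submodule (𝓞 K) (Fin n → K)} (hΓ : IsOKLattice e Γ) (R : ℝ) :
    {x | x ∈ Γ ∧ bodyNorm e B x ≤ R}.Finite := by
  let f : (Fin n → K) →+ (Fin n → Fin d → ℝ) :=
    AddMonoidHom.mk' (fun x => coords e n (embed x)) fun x y => by rw [embed_add, map_add]
  let H : AddSubgroup (Fin n → Fin d → ℝ) := Γ.toAddSubgroup.map f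
  have hdisc : DiscreteTopology H := hΓ
  have hbdd : Bornology.IsBounded ((|R| + 1) • (coords e n '' B)) := hB.bounded.smul₀ _
  have hfin : (((|R| + 1) • (coords e n '' B)) ∩ (H : Set (Fin n → Fin d → ℝ))).Finite :=
    Metric.finite_isBounded_inter_isClosed DiscreteTopology.isDiscrete hbdd
      AddSubgroup.isClosed_of_discrete
  refine Set.Finite.of_finite_image (f := f) (hfin.subset ?_) (coords_embed_injective e).injOn
  rintro _ ⟨x, ⟨hxΓ, hxR⟩, rfl⟩
  refine ⟨?_, x, hxΓ, rfl⟩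
  by_contra hnot
  have hle := le_gauge_of_notMem (hB.convex_image.starConvex hB.zero_mem_image)
    (hB.absorbent_image _) hnot
  have : |R| + 1 ≤ R := hle.trans hxR
  linarith [le_abs_self R]

end IsSymmConvexBody

end Gauge

end OKGeom

/-! ### Choice of constants and the two inclusions -/

theorem lemma4p7 {K : Type*} [Field K] [NumberField K] {d : ℕ}
    (e : Module.Basis (Fin d) ℤ (𝓞 K)) (n : ℕ) (r : ℝ) (hr : 1 ≤ r) :
    ∃ D₁ D₂ : ℕ, 0 < D₁ ∧ 0 < D₂ ∧
      ∀ (Γ : Submodule (𝓞 K) (Fin n → K)) (B : Set (Fin n → OKGeom.KR K)),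
        OKGeom.IsOKLattice e Γ → OKGeom.IsFullRank Γ →
        OKGeom.IsSymmConvexBody e B → OKGeom.IsThick e r B →
        ∃ (v : Fin n → (Fin n → K)) (L : Fin n → ℕ), (∀ j, 0 < L j) ∧
          OKGeom.gap e 0 v L ⊆ OKGeom.embed ⁻¹' B ∩ (Γ : Set (Fin n → K)) ∧
          OKGeom.embed ⁻¹' B ∩ (Γ : Set (Fin n → K)) ⊆
            (D₂ : K)⁻¹ • OKGeom.gap e 0 v (fun j => D₁ * L j) := by
  open OKGeom in
  have hr0 : 0 ≤ r := zero_le_one.trans hr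
  obtain ⟨m, hm, hmr⟩ : ∃ m : ℕ, 0 < m ∧ 2 * n * d * r ≤ m := by
    obtain ⟨m, hm⟩ := exists_nat_ge (2 * n * d * r)
    exact ⟨m + 1, m.succ_pos, by push_cast; linarith⟩
  set Q : ℕ := m ^ (n * d) with hQ
  set D₂ : ℕ := Q.factorial ^ n with hD₂
  have hD₂0 : 0 < D₂ := pow_pos (Nat.factorial_pos _) _
  set C : ℝ := 2 * Q * (1 + d * r * (2 * Q)) ^ n with hC
  have hC0 : 0 ≤ C := by positivity
  -- Cleared coordinates satisfy `|l| * N (b j) ≤ D₂ * C`, and `1 ≤ L j * (n * d * r * N (b j))`.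
  obtain ⟨D₁, hD₁⟩ := exists_nat_gt (D₂ * C * (n * d * r))
  have hD₁0 : 0 < D₁ := by
    have : (0 : ℝ) < D₁ := lt_of_le_of_lt (by positivity) hD₁
    exact_mod_cast this
  refine ⟨D₁, D₂, hD₁0, hD₂0, fun Γ B hΓ hfull hB hthick => ?_⟩
  have hN := hB.isThickNorm hr0 hthick
  obtain ⟨b, hb⟩ := exists_isMinimalBasis (K := K) (W := Fin n → K) (n := n) (by simp)
    (Γ := Γ.toAddSubgroup) (fun l x hx => Γ.smul_mem l hx) hfull (hB.finite_bodyNorm_le hΓ)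
  set N := bodyNorm e B
  have hpos : ∀ j, 0 < N (b j) := fun j => hN.pos _ (b.ne_zero j)
  have hd : 0 < d := by
    rcases Nat.eq_zero_or_pos d with rfl | h
    · have : Subsingleton (𝓞 K) := e.repr.toEquiv.subsingleton
      exact absurd (zero_ne_one (α := 𝓞 K)) (by simp [Subsingleton.elim (0 : 𝓞 K) 1])
    · exact h
  have hndr : ∀ j : Fin n, (0 : ℝ) < n * d * r := fun j => by
    have h1 : (0 : ℝ) < n := by exact_mod_cast j.pos
    have h2 : (0 : ℝ) < d := by exact_mod_cast hd
    positivity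
  have hinv : ∀ j, 0 < 1 / (n * d * r * N (b j)) := fun j =>
    one_div_pos.2 (mul_pos (hndr j) (hpos j))
  -- The ceiling serves both inclusions: integers below `L j` are at most `L j - 1 < 1 / (n d r N (b
  -- j)) ≤ L j`.
  refine ⟨b, fun j => ⌈1 / (n * d * r * N (b j))⌉₊, fun j => Nat.ceil_pos.2 (hinv j), ?_, ?_⟩
  · rintro x ⟨l, hl, rfl⟩
    rw [zero_add]
    refine ⟨(hB.bodyNorm_lt_one_iff _).1 ?_, hb.sum_mem l⟩
    have hterm : ∀ j ∈ Finset.univ, N ((l j : K) • b j) < 1 / n := fun j _ => by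
      set L : ℕ := ⌈1 / (n * d * r * N (b j))⌉₊ with hL
      have hLlt : (L : ℝ) - 1 < 1 / (n * d * r * N (b j)) := by
        linarith [Nat.ceil_lt_add_one (hinv j).le]
      have hcoord : ∀ i, |((ratBasis e).repr (l j : K) i : ℝ)| ≤ (L : ℝ) - 1 := fun i => by
        rw [ratBasis_repr_coe, Rat.cast_intCast]
        have h : |e.repr (l j) i| ≤ (L : ℤ) - 1 := Int.le_sub_one_of_lt (hl j i)
        exact_mod_cast h
      have hn0 : (0 : ℝ) < n := by exact_mod_cast j.pos
      have hd0 : (0 : ℝ) < d := by exact_mod_cast hd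
      have := hpos j
      have hr1 : 0 < r := by linarith
      calc N ((l j : K) • b j) ≤ d * r * ((L : ℝ) - 1) * N (b j) := hN.smul_le hcoord _
        _ < d * r * (1 / (n * d * r * N (b j))) * N (b j) := by gcongr
        _ = 1 / n := by field_simp
    -- The strict bound on the sum needs a nonempty index set.
    rcases Nat.eq_zero_or_pos n with rfl | hn
    · simp only [Finset.univ_eq_empty, Finset.sum_empty]
      exact hN.zero.trans_lt zero_lt_one
    · have hne : (Finset.univ : Finset (Fin n)).Nonempty := ⟨⟨0, hn⟩, Finset.mem_univ _⟩
      refine ((hN.sum_le _ _).trans_lt (Finset.sum_lt_sum_of_nonempty hne hterm)).trans_eq ?_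
      have hn0 : (n : ℝ) ≠ 0 := by exact_mod_cast hn.ne'
      simp [hn0]
  · rintro x ⟨hxB, hxΓ⟩
    have hx1 : N x < 1 := (hB.bodyNorm_lt_one_iff x).2 hxB
    have hsupp : ∀ j : Fin n, n ≤ j → b.repr x j = 0 := fun j hj => absurd j.2 (not_lt.2 hj)
    choose l hl using fun j => hb.exists_integral_repr hN hr0 hm hmr n le_rfl hxΓ hsupp j
    have hD₂K : (D₂ : K) ≠ 0 := by exact_mod_cast hD₂0.ne'
    rw [Set.mem_inv_smul_set_iff₀ hD₂K]
    refine ⟨l, fun j i => ?_, ?_⟩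
    · set L : ℕ := ⌈1 / (n * d * r * N (b j))⌉₊ with hL
      have hLge : 1 / (n * d * r * N (b j)) ≤ L := Nat.le_ceil _
      have hbound : |((ratBasis e).repr (b.repr x j) i : ℝ)| * N (b j) ≤ C * N x :=
        hb.abs_repr_le hN hr0 hm hmr n le_rfl hsupp j i
      have hcoord : (e.repr (l j) i : ℝ) = D₂ * ((ratBasis e).repr (b.repr x j) i : ℝ) := by
        have h := ratBasis_repr_coe e (l j) i
        rw [← hl j, ratBasis_repr_natCast_mul] at h
        exact_mod_cast h.symm
      have hNx : C * N x ≤ C := mul_le_of_le_one_right hC0 hx1.le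
      have hLN : 1 ≤ L * (n * d * r * N (b j)) := (div_le_iff₀ (mul_pos (hndr j) (hpos j))).1 hLge
      have hLpos : (0 : ℝ) < L := (hinv j).trans_le hLge
      have hreal : |(e.repr (l j) i : ℝ)| < D₁ * L := by
        refine lt_of_mul_lt_mul_right ?_ (hpos j).le
        calc |(e.repr (l j) i : ℝ)| * N (b j)
            = D₂ * (|((ratBasis e).repr (b.repr x j) i : ℝ)| * N (b j)) := by
              rw [hcoord, abs_mul, Nat.abs_cast, mul_assoc]
          _ ≤ D₂ * C * 1 := by
              rw [mul_one]
              exact mul_le_mul_of_nonneg_left (hbound.trans hNx) (Nat.cast_nonneg _)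
          _ ≤ D₂ * C * (L * (n * d * r * N (b j))) := by gcongr
          _ = D₂ * C * (n * d * r) * (L * N (b j)) := by ring
          _ < D₁ * (L * N (b j)) := mul_lt_mul_of_pos_right hD₁ (mul_pos hLpos (hpos j))
          _ = D₁ * L * N (b j) := by ring
      have : |e.repr (l j) i| < (D₁ : ℤ) * L := by exact_mod_cast hreal
      rw [← Nat.cast_mul] at this
      exact this
    · rw [zero_add]
      conv_lhs => rw [← b.sum_repr x, Finset.smul_sum]
      refine Finset.sum_congr rfl fun j _ => ?_
      rw [smul_smul, hl j]
      rfl
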